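/- Let $\mathbb{F}_q$ be a finite field of characteristic $p$. For integers $s\ge 1$ and $1\le i\le p^s-1$ let $\mathcal{C}_i=\langle (x-1)^i\rangle\subseteq \mathbb{F}_q[x]/\langle x^{p^s}-1\rangle$, regarded as a cyclic linear code of length $p^s$ over $\mathbb{F}_q$ by identifying $(c_0,\dots,c_{p^s-1})$ with the class of $\sum_j c_jx^j$. For a linear code $C\subseteq\mathbb{F}_q^n$, the $j$-th symbol has locality $r_j$ if $r_j$ is the smallest size of a set $S\subseteq\{0,\dots,n-1\}\setminus\{j\}$ for which there are nonzero $\lambda_t\in\mathbb{F}_q$ $(t\in S)$ with $c_j=\sum_{t\in S}\lambda_tc_t$ for all $c\in C$; the locality of $C$ is $r=\max_j r_j$. A linear code with length $n$, dimension $k$, minimum Hamming distance $d$ and locality $r\ge 1$ is called an optimal $(n,k,d,r)$ locally repairable code (LRC) if $n-k=\lceil k/r\rceil+d-2$. Then the following are optimal cyclic LRCs. 1. If $p=2$ and $s\ge 2$: $\mathcal{C}_{2^{s-1}+1}$, with parameters $(2^s,\,2^{s-1}-1,\,4,\,1)$. 2. If $s\ge 2$ and $1\le k\le s-1$: $\mathcal{C}_{p^{s-k-1}}$,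 with parameters $(p^s,\,p^s-p^{s-k-1},\,2,\,p^{k+1}-1)$. 3. If $p\ge 3$ and $s\ge 2$: $\mathcal{C}_{2}$, with parameters $(p^s,\,p^s-2,\,2,\,p^s-p^{s-1}-1)$. 4. If $p\ge 3$ and $s\ge 2$: $\mathcal{C}_{p^{s-1}+1}$, with parameters $(p^s,\,p^s-p^{s-1}-1,\,3,\,p-1)$. 5. If $s\ge 1$: $\mathcal{C}_{p^{s-1}}$, with parameters $(p^s,\,p^s-p^{s-1},\,2,\,p-1)$. In each of these five classes the code length $p^s$ is unbounded for the fixed field $\mathbb{F}_q$. There are two further families of optimal cyclic LRCs: 6. If $s\ge 1$: $\mathcal{C}_{p^s-1}$, with parameters $(p^s,\,1,\,p^s,\,1)$. 7. If $s=1$ and $0\le t\le p-2$: $\mathcal{C}_{t+1}$, with parameters $(p,\,p-t-1,\,t+2,\,p-t-1)$. Moreover these are all: if $s\ge 1$, $1\le i\le p^s-1$ and $\mathcal{C}_i$ is an optimal LRC, then $\mathcal{C}_i$ belongs to one of the seven families 1–7. -/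

import Mathlib

open Polynomial

/-- The `F`-linear map sending a vector `(c_0, …, c_{n-1})` to the class of its polynomial
representation `c_0 + c_1 x + ⋯ + c_{n-1} x^{n-1}` in `F[x] / ⟨x^n - 1⟩`. -/
noncomputable def vecToQuotient (F : Type*) [Field F] (n : ℕ) :
    (Fin n → F) →ₗ[F] (F[X] ⧸ Ideal.span {(X ^ n - 1 : F[X])}) :=
  (Ideal.Quotient.mkₐ F (Ideal.span {(X ^ n - 1 : F[X])})).toLinearMap ∘ₗ
    ∑ j : Fin n, (monomial (j : ℕ) : F →ₗ[F] F[X]) ∘ₗ LinearMap.proj j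

/-- The code of length `n` over `F` consisting of all vectors whose polynomial representation
lies in the ideal `⟨(x - 1)^i⟩` of `F[x] / ⟨x^n - 1⟩`. -/
noncomputable def rootOneCode (F : Type*) [Field F] (n i : ℕ) : Submodule F (Fin n → F) :=
  Submodule.comap (vecToQuotient F n)
    (Submodule.restrictScalars F
      (Ideal.span {Ideal.Quotient.mk (Ideal.span {(X ^ n - 1 : F[X])}) ((X - 1) ^ i)}))

/-- A linear code is cyclic if it is closed under the shift
`(c_0, …, c_{n-1}) ↦ (c_{n-1}, c_0, …, c_{n-2})`. -/
def IsCyclicCode {F : Type*} [Field F] {n : ℕ} (C : Submodule F (Fin n → F)) : Prop :=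
  ∀ c ∈ C, (fun j => c ((finRotate n).symm j)) ∈ C

open Classical in
/-- `d` is the minimum Hamming distance of `C`. -/
def IsMinDistance {F : Type*} [Field F] {n : ℕ} (C : Submodule F (Fin n → F)) (d : ℕ) : Prop :=
  IsLeast {w | ∃ x ∈ C, ∃ y ∈ C, x ≠ y ∧ hammingDist x y = w} d

/-- The `j`-th symbol of `C` is the linear combination, with nonzero coefficients, of the symbols
with index in `S`, where `j ∉ S`. In terms of the columns of a generator matrix, this is
`g_j = ∑ t ∈ S, a_t g_t` (see `isRepairSet_iff_generator`). -/
def IsRepairSet {F : Type*} [Field F] {n : ℕ} (C : Submodule F (Fin n → F)) (j : Fin n)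
    (S : Finset (Fin n)) : Prop :=
  j ∉ S ∧ ∃ a : Fin n → F, (∀ t ∈ S, a t ≠ 0) ∧ ∀ c ∈ C, c j = ∑ t ∈ S, a t * c t

/-- Repair sets, expressed through the columns of a matrix whose rows span the code. -/
theorem isRepairSet_iff_generator {F : Type*} [Field F] {n k : ℕ} (C : Submodule F (Fin n → F))
    (G : Matrix (Fin k) (Fin n) F) (hG : Submodule.span F (Set.range G) = C) (j : Fin n)
    (S : Finset (Fin n)) :
    IsRepairSet C j S ↔
      j ∉ S ∧ ∃ a : Fin n → F, (∀ t ∈ S, a t ≠ 0) ∧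
        (fun l => G l j) = ∑ t ∈ S, a t • (fun l => G l t) := by
  unfold IsRepairSet
  refine and_congr_right fun _ => exists_congr fun a => and_congr_right fun _ => ?_
  constructor
  · intro h
    funext l
    have := h (G l) (hG ▸ Submodule.subset_span ⟨l, rfl⟩)
    simpa [Finset.sum_apply] using this
  · intro h c hc
    rw [← hG] at hc
    induction hc using Submodule.span_induction with
    | mem x hx =>
      obtain ⟨l, rfl⟩ := hx
      have := congrFun h l
      simpa [Finset.sum_apply] using this
    | zero => simp
    | add x y _ _ hx hy => simp [hx, hy, mul_add, Finset.sum_add_distrib]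
    | smul b x _ hx =>
      simp only [Pi.smul_apply, smul_eq_mul, hx, Finset.mul_sum]
      exact Finset.sum_congr rfl fun t _ => by ring

/-- The `j`-th symbol of `C` has locality `r`: `r` is the smallest size of a repair set. -/
def HasSymbolLocality {F : Type*} [Field F] {n : ℕ} (C : Submodule F (Fin n → F)) (j : Fin n)
    (r : ℕ) : Prop :=
  IsLeast {m | ∃ S : Finset (Fin n), IsRepairSet C j S ∧ S.card = m} r

/-- `C` has (all-symbol) locality `r`: every symbol has a locality, and `r` is the maximum of the
localities of the symbols. -/
def HasLocality {F : Type*} [Field F] {n : ℕ} (C : Submodule F (Fin n → F)) (r : ℕ) : Prop :=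
  ∃ ρ : Fin n → ℕ, (∀ j, HasSymbolLocality C j (ρ j)) ∧ IsGreatest (Set.range ρ) r

/-- `C` is an optimal `(n, k, d, r)` cyclic locally repairable code: a cyclic code of length `n`,
dimension `k`, minimum distance `d` and locality `r ≥ 1`, with `n - k = ⌈k / r⌉ + d - 2`. -/
def IsOptimalCyclicLRC {F : Type*} [Field F] {n : ℕ} (C : Submodule F (Fin n → F))
    (k d r : ℕ) : Prop :=
  IsCyclicCode C ∧ Module.finrank F C = k ∧ IsMinDistance C d ∧ HasLocality C r ∧ 1 ≤ r ∧
    (n : ℤ) - k = ⌈(k : ℚ) / (r : ℚ)⌉ + d - 2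

/-!
Write `n = p ^ s`. In characteristic `p` one has `X ^ n - 1 = (X - 1) ^ n`, so a vector lies in
`⟨(x - 1) ^ i⟩` exactly when `(X - 1) ^ i` divides its polynomial (`mem_rootOneCode_iff`). The
dimension is then `j = n - i`.

The minimum distance depends only on the leading base-`p` digit `a` of `j` and its position `e`: it
is `(p + 1 - a) * p ^ (s - 1 - e)` (`isMinDistance_rootOneCode`). A power of `X - 1` that splits
into factors `(X ^ (p ^ m) - 1) ^ t` attains it (`card_support_X_sub_one_pow_le`). The lower bound
(`le_card_support_of_pow_dvd`) is an induction on `s`: with `q = p ^ (s - 1)`, pull the largest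
power `(X ^ q - 1) ^ v` out of a polynomial and reduce the cofactor modulo `X ^ q - 1` to get `g`;
each term of `g` accounts for at least `v + 1` terms of the polynomial (`mul_card_support_mod_le`),
because a nonzero polynomial of degree below `p` divisible by `(X - 1) ^ v` has more than `v` terms
(`lt_card_support_of_pow_dvd`).

Up to reversing the coordinates, the dual code is `⟨(x - 1) ^ j⟩` (`rev_mem_rootOneCode_iff`).
Repair sets are supports of dual words, and by cyclicity a dual word of least weight can be moved to any
position, so every symbol has locality one less than the minimum distance of `⟨(x - 1) ^ j⟩`
(`hasSymbolLocality_rootOneCode`).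

Optimality thus becomes an arithmetic condition on the leading digits of `i` and `j`
(`isOptimalCyclicLRC_rootOneCode_iff`). The families satisfy it. Conversely `i + j = p ^ s` forces
one of the two leading digits to stand at the top position `s - 1`; the three resulting cases are
`eq_or_eq_two_of_pred_mul_lt`, `eq_pred_or_eq_add_one_of_optimal` and
`eq_or_eq_add_one_of_optimal`.
-/

/-! ### Weights of polynomials divisible by powers of `X - 1` -/

section Weights

variable {F : Type*} [Field F]

theorem two_le_card_support_of_X_sub_one_dvd {f : F[X]} (hf : f ≠ 0) (h : (X - 1 : F[X]) ∣ f) :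
    2 ≤ f.support.card := by
  have h1 : f.eval 1 = 0 := by
    have : (X - C (1 : F)) ∣ f := by simpa using h
    exact dvd_iff_isRoot.mp this
  by_contra hlt
  have hpos : f.support.card ≠ 0 := by simpa using hf
  obtain ⟨k, x, hx, rfl⟩ := card_support_eq_one.mp (show f.support.card = 1 by omega)
  simp at h1
  exact hx h1

/-- The operator `f ↦ X f' - a f` multiplies the coefficient of `X ^ m` by `m - a`, so it removes
exactly the exponent `a` when the degree is below the characteristic, and it lowers the
multiplicity of the root `1` by at most one. -/
theorem lt_card_support_of_pow_dvd (p : ℕ) [CharP F p] (v : ℕ) :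
    ∀ f : F[X], f ≠ 0 → f.natDegree < p → (X - 1 : F[X]) ^ v ∣ f → v < f.support.card := by
  induction v with
  | zero =>
    intro f hf _ _
    have : f.support.card ≠ 0 := by simpa using hf
    omega
  | succ v ih =>
    intro f hf hdeg hdvd
    have htwo : 2 ≤ f.support.card :=
      two_le_card_support_of_X_sub_one_dvd hf ((dvd_pow_self _ (Nat.succ_ne_zero v)).trans hdvd)
    set a := f.natDegree with ha
    have ham : a ∈ f.support := natDegree_mem_support_of_nonzero hf
    set w : F[X] := X * derivative f - C (a : F) * f with hw
    have hcoeff : ∀ m, w.coeff m = ((m : F) - a) * f.coeff m := by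
      intro m
      rcases m with _ | m
      · simp [hw]
      · simp only [hw, coeff_sub, coeff_X_mul, coeff_derivative, coeff_C_mul]
        push_cast
        ring
    have hsupp : w.support = f.support.erase a := by
      ext m
      rw [mem_support_iff, hcoeff, Finset.mem_erase, mem_support_iff, mul_ne_zero_iff, sub_ne_zero]
      refine and_congr_left fun hm => not_congr ⟨fun h => ?_, fun h => by rw [h]⟩
      have hlt : m < p := (le_natDegree_of_ne_zero hm).trans_lt hdeg
      exact Nat.ModEq.eq_of_lt_of_lt ((CharP.natCast_eq_natCast F p).mp h) hlt hdeg
    have hcard : w.support.card + 1 = f.support.card := by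
      rw [hsupp, Finset.card_erase_of_mem ham]
      omega
    have hw0 : w ≠ 0 := by
      rintro h0
      rw [h0] at hcard
      simp at hcard
      omega
    have hwdeg : w.natDegree < p :=
      (natDegree_le_iff_coeff_eq_zero.mpr fun m hm => by
        rw [hcoeff, coeff_eq_zero_of_natDegree_lt hm, mul_zero] : w.natDegree ≤ a).trans_lt hdeg
    have hwdvd : (X - 1 : F[X]) ^ v ∣ w := by
      refine dvd_sub (Dvd.dvd.mul_left ?_ _) (Dvd.dvd.mul_left ?_ _)
      · simpa using pow_sub_one_dvd_derivative_of_pow_dvd hdvd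
      · exact (pow_dvd_pow _ (Nat.le_succ v)).trans hdvd
    have := ih w hw0 hwdeg hwdvd
    omega

/-- The polynomial `∑ b, f_{c + b q} X ^ b` formed by the coefficients of `f` whose index is
`c + b q`. For `0 < q` these polynomials, for `c < q`, are the coordinates of `f` in
`F[X]` as a free module over `F[X ^ q]`. -/
noncomputable def coeffSection (q c : ℕ) (f : F[X]) : F[X] :=
  ∑ b ∈ Finset.range (f.natDegree + 1), monomial b (f.coeff (c + b * q))

theorem coeff_coeffSection {q : ℕ} (hq : 0 < q) (c : ℕ) (f : F[X]) (b : ℕ) :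
    (coeffSection q c f).coeff b = f.coeff (c + b * q) := by
  simp only [coeffSection, coeff_monomial, Finset.sum_ite_eq', finsetSum_coeff, Finset.mem_range,
    ite_eq_left_iff]
  intro hb
  refine (coeff_eq_zero_of_natDegree_lt ?_).symm
  nlinarith

theorem coeffSection_X_pow_sub_one_mul {q c : ℕ} (hc : c < q) (f : F[X]) :
    coeffSection q c ((X ^ q - 1) * f) = (X - 1) * coeffSection q c f := by
  have hq : 0 < q := by omega
  ext b
  rw [coeff_coeffSection hq, sub_mul, sub_mul, one_mul, one_mul, coeff_sub, coeff_sub,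
    coeff_coeffSection hq]
  congr 1
  rcases b with _ | b
  · rw [coeff_X_pow_mul', if_neg (by omega)]
    simp
  · rw [coeff_X_mul, coeff_coeffSection hq, ← coeff_X_pow_mul f q (c + b * q)]
    congr 1
    ring

theorem coeffSection_X_pow_sub_one_pow_mul {q c : ℕ} (hc : c < q) (v : ℕ) (f : F[X]) :
    coeffSection q c ((X ^ q - 1) ^ v * f) = (X - 1) ^ v * coeffSection q c f := by
  induction v with
  | zero => simp
  | succ v ih =>
    rw [pow_succ', mul_assoc, coeffSection_X_pow_sub_one_mul hc, ih, pow_succ', mul_assoc]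

theorem eval_one_coeffSection {q c : ℕ} (hc : c < q) (f : F[X]) :
    (coeffSection q c f).eval 1 = (f %ₘ (X ^ q - 1)).coeff c := by
  have hq : 0 < q := by omega
  have hmon : (X ^ q - 1 : F[X]).Monic := by simpa using monic_X_pow_sub_C (1 : F) hq.ne'
  set g := f %ₘ (X ^ q - 1) with hg
  have hgdeg : g.degree < q := by
    have := degree_modByMonic_lt f hmon
    rwa [show (X ^ q - 1 : F[X]).degree = q by simpa using degree_X_pow_sub_C hq (1 : F)] at this
  have hsplit : coeffSection q c f =
      (X - 1) * coeffSection q c (f /ₘ (X ^ q - 1)) + C (g.coeff c) := by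
    rw [← coeffSection_X_pow_sub_one_mul hc]
    ext b
    rw [coeff_add, coeff_coeffSection hq, coeff_coeffSection hq, coeff_C]
    conv_lhs => rw [← modByMonic_add_div f (X ^ q - 1), ← hg, add_comm, coeff_add]
    congr 1
    split_ifs with hb
    · simp [hb]
    · refine coeff_eq_zero_of_degree_lt (hgdeg.trans_le ?_)
      have : 1 ≤ b := by omega
      exact_mod_cast (by nlinarith : q ≤ c + b * q)
  rw [hsplit]
  simp

/-- Every exponent `c` of the remainder of `h` modulo `X ^ q - 1` gives a nonzero section of
`(X ^ q - 1) ^ v * h`, which is divisible by `(X - 1) ^ v` and so has more than `v` terms. -/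
theorem mul_card_support_mod_le (p : ℕ) [CharP F p] {q : ℕ} (hq : 0 < q) (v : ℕ) (h : F[X])
    (hdeg : ((X ^ q - 1) ^ v * h).natDegree < p * q) :
    (v + 1) * (h %ₘ (X ^ q - 1)).support.card ≤ ((X ^ q - 1) ^ v * h).support.card := by
  set f := (X ^ q - 1) ^ v * h with hf
  set g := h %ₘ (X ^ q - 1) with hg
  have hmon : (X ^ q - 1 : F[X]).Monic := by simpa using monic_X_pow_sub_C (1 : F) hq.ne'
  have hgdeg : g.degree < q := by
    have := degree_modByMonic_lt h hmon
    rwa [show (X ^ q - 1 : F[X]).degree = q by simpa using degree_X_pow_sub_C hq (1 : F)] at this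
  have hlt : ∀ c ∈ g.support, c < q := fun c hc =>
    by exact_mod_cast (le_degree_of_ne_zero (mem_support_iff.mp hc)).trans_lt hgdeg
  have hsec : ∀ c ∈ g.support, v + 1 ≤ (coeffSection q c f).support.card := by
    intro c hc
    have hcq := hlt c hc
    have hsh : coeffSection q c h ≠ 0 := by
      intro h0
      have := eval_one_coeffSection hcq h
      rw [h0, eval_zero] at this
      exact mem_support_iff.mp hc this.symm
    have hX : (X - 1 : F[X]) ≠ 0 := by simpa using X_sub_C_ne_zero (1 : F)
    have hprod := coeffSection_X_pow_sub_one_pow_mul hcq v h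
    have hne : coeffSection q c f ≠ 0 := by
      rw [hf, hprod]
      exact mul_ne_zero (pow_ne_zero _ hX) hsh
    refine lt_card_support_of_pow_dvd p v _ hne ?_ ⟨_, hprod⟩
    have hlead := mt leadingCoeff_eq_zero.mp hne
    rw [leadingCoeff, coeff_coeffSection hq] at hlead
    have := (le_natDegree_of_ne_zero hlead).trans_lt hdeg
    exact lt_of_mul_lt_mul_right ((Nat.le_add_left _ c).trans_lt this) (Nat.zero_le q)
  calc (v + 1) * g.support.card = ∑ _c ∈ g.support, (v + 1) := by simp [mul_comm]
    _ ≤ ∑ c ∈ g.support, (coeffSection q c f).support.card := Finset.sum_le_sum hsec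
    _ = (g.support.sigma fun c => (coeffSection q c f).support).card := by
        rw [Finset.card_sigma]
    _ ≤ f.support.card := by
        refine Finset.card_le_card_of_injOn (fun x => x.1 + x.2 * q) ?_ ?_
        · rintro ⟨c, b⟩ hx
          simp only [Finset.coe_sigma, Set.mem_sigma_iff, Finset.mem_coe, mem_support_iff,
            coeff_coeffSection hq] at hx ⊢
          exact hx.2
        · rintro ⟨c, b⟩ hx ⟨c', b'⟩ hx' heq
          simp only [Finset.coe_sigma, Set.mem_sigma_iff, Finset.mem_coe] at hx hx' heq
          have h1 := hlt c hx.1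
          have h2 := hlt c' hx'.1
          have hcc : c = c' := by
            have := congrArg (· % q) heq
            simpa [Nat.mod_eq_of_lt h1, Nat.mod_eq_of_lt h2] using this
          subst hcc
          have : b = b' := Nat.eq_of_mul_eq_mul_right hq (by omega)
          rw [this]

theorem X_pow_sub_one_eq_pow (p : ℕ) [Fact p.Prime] [CharP F p] (s : ℕ) :
    (X ^ p ^ s - 1 : F[X]) = (X - 1) ^ p ^ s := by
  rw [sub_pow_char_pow, one_pow]

/-- Induction on `s`. With `q = p ^ s`, a polynomial `f` of degree below `p ^ (s + 1)` is
`(X ^ q - 1) ^ v * h` with nonzero remainder `g` of `h` modulo `X ^ q - 1`, the weight of `f` is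
at least `v + 1` times that of `g`, and the multiplicity of the root `1` of `f` is `v q` plus that
of `g`. -/
theorem le_card_support_of_pow_dvd (p : ℕ) [Fact p.Prime] [CharP F p] (s : ℕ) :
    ∀ (e a j i : ℕ) (f : F[X]), i + j = p ^ s → e < s → 1 ≤ a → a < p → j < (a + 1) * p ^ e →
      f ≠ 0 → f.natDegree < p ^ s → (X - 1 : F[X]) ^ i ∣ f →
        (p + 1 - a) * p ^ (s - 1 - e) ≤ f.support.card := by
  have hp := (Fact.out : p.Prime)
  have hX : (X - 1 : F[X]) ≠ 0 := by simpa using X_sub_C_ne_zero (1 : F)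
  induction s with
  | zero => intro e a j i f _ he; omega
  | succ s ih =>
    intro e a j i f hij he ha1 hap hj hf hdeg hdvd
    set q := p ^ s with hq
    have hqpos : 0 < q := pow_pos hp.pos s
    have hpq : p ^ (s + 1) = p * q := by rw [pow_succ, mul_comm]
    have hmon : (X ^ q - 1 : F[X]).Monic := by simpa using monic_X_pow_sub_C (1 : F) hqpos.ne'
    have hXq : (X ^ q - 1 : F[X]) = (X - 1) ^ q := X_pow_sub_one_eq_pow p s
    have hdegq : (X ^ q - 1 : F[X]).natDegree = q := by
      simpa using natDegree_X_pow_sub_C (n := q) (r := (1 : F))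
    have hfin : FiniteMultiplicity (X ^ q - 1 : F[X]) f := by
      refine finiteMultiplicity_of_degree_pos_of_monic ?_ hmon hf
      rw [show (X ^ q - 1 : F[X]).degree = q by simpa using degree_X_pow_sub_C hqpos (1 : F)]
      exact_mod_cast hqpos
    obtain ⟨h, hfh, hnd⟩ := hfin.exists_eq_pow_mul_and_not_dvd
    set v := multiplicity (X ^ q - 1 : F[X]) f
    set g := h %ₘ (X ^ q - 1) with hg
    have hh : h ≠ 0 := by rintro rfl; simp at hnd
    have hg0 : g ≠ 0 := by rwa [hg, Ne, modByMonic_eq_zero_iff_dvd hmon]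
    have hgdeg : g.natDegree < q := by
      have := natDegree_modByMonic_lt h hmon (by
        intro h1
        rw [h1, natDegree_one] at hdegq
        omega)
      rwa [hdegq] at this
    have hwt : (v + 1) * g.support.card ≤ f.support.card := by
      have := mul_card_support_mod_le p hqpos v h (by rw [← hfh, ← hpq]; exact hdeg)
      rwa [← hfh] at this
    have hvp : v < p := by
      have : f.natDegree = v * q + h.natDegree := by
        conv_lhs => rw [hfh]
        rw [natDegree_mul (pow_ne_zero _ hmon.ne_zero) hh, natDegree_pow, hdegq]
      rw [this, hpq] at hdeg
      exact lt_of_mul_lt_mul_right ((Nat.le_add_right _ _).trans_lt hdeg) (Nat.zero_le q)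
    have hfh' : f = (X - 1) ^ (v * q) * h := by rw [hfh, hXq, ← pow_mul, mul_comm q v]
    have hdvdh : ∀ i', v * q + i' ≤ i → (X - 1 : F[X]) ^ i' ∣ h := by
      intro i' hi'
      have h1 : (X - 1 : F[X]) ^ (v * q + i') ∣ f := (pow_dvd_pow _ hi').trans hdvd
      rw [hfh', pow_add] at h1
      exact (mul_dvd_mul_iff_left (pow_ne_zero _ hX)).mp h1
    have hiv : i < (v + 1) * q := by
      by_contra hcon
      refine hnd ?_
      rw [hXq]
      exact hdvdh q (by linarith)
    have hdvdg : ∀ i', v * q + i' ≤ i → (X - 1 : F[X]) ^ i' ∣ g := by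
      intro i' hi'
      have hle : i' ≤ q := by linarith
      have h1 := hdvdh i' hi'
      rw [hg, modByMonic_eq_sub_mul_div]
      refine dvd_sub h1 (Dvd.dvd.mul_right ?_ _)
      rw [hXq]
      exact pow_dvd_pow _ hle
    have hgpos : 1 ≤ g.support.card := by
      have : g.support.card ≠ 0 := by simpa using hg0
      omega
    rw [hpq] at hij
    rcases Nat.lt_or_ge e s with hes | hes
    · -- here the leading base-`p` digit of `i` is `p - 1`
      have hjq : j < q := by
        calc j < (a + 1) * p ^ e := hj
          _ ≤ p * p ^ e := Nat.mul_le_mul_right _ hap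
          _ = p ^ (e + 1) := by rw [pow_succ, mul_comm]
          _ ≤ q := Nat.pow_le_pow_right hp.pos hes
      have hvp1 : v + 1 = p := by
        have h1 : (p - 1) * q < (v + 1) * q := by
          have : (p - 1) * q + q = p * q := by
            rw [← Nat.succ_mul, Nat.succ_eq_add_one, Nat.sub_add_cancel hp.one_le]
          omega
        have := lt_of_mul_lt_mul_right h1 (Nat.zero_le q)
        omega
      have hvq : v * q + q = p * q := by rw [← Nat.succ_mul, Nat.succ_eq_add_one, hvp1]
      have hrec := ih e a j (q - j) g (by omega) hes ha1 hap hj hg0 hgdeg (hdvdg _ (by omega))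
      calc (p + 1 - a) * p ^ (s + 1 - 1 - e) = p * ((p + 1 - a) * p ^ (s - 1 - e)) := by
            rw [show s + 1 - 1 - e = (s - 1 - e) + 1 by omega, pow_succ]
            ring
        _ ≤ p * g.support.card := Nat.mul_le_mul_left _ hrec
        _ ≤ f.support.card := hvp1 ▸ hwt
    · obtain rfl : e = s := by omega
      rw [← hq] at hj
      rw [show e + 1 - 1 - e = 0 by omega, pow_zero, mul_one]
      have h1 : (p - a - 1) * q + (a + 1) * q = p * q := by
        rw [← add_mul]; congr 1; omega
      have h2 : p - a - 1 < v + 1 :=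
        lt_of_mul_lt_mul_right (by omega : (p - a - 1) * q < (v + 1) * q) (Nat.zero_le q)
      rcases Nat.lt_or_ge v (p - a) with hv | hv
      · have hv' : v = p - a - 1 := by omega
        have h3 : 2 ≤ g.support.card := by
          refine two_le_card_support_of_X_sub_one_dvd hg0 ?_
          simpa using hdvdg 1 (by rw [hv']; omega)
        have h4 : (v + 1) * 2 ≤ (v + 1) * g.support.card := Nat.mul_le_mul_left _ h3
        omega
      · have h4 : (v + 1) * 1 ≤ (v + 1) * g.support.card := Nat.mul_le_mul_left _ hgpos
        omega

theorem card_support_X_pow_sub_one_pow_le {m : ℕ} (hm : 0 < m) (t : ℕ) :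
    ((X ^ m - 1 : F[X]) ^ t).support.card ≤ t + 1 := by
  have h1 : (X ^ m - 1 : F[X]) ^ t = expand F m ((X - 1) ^ t) := by simp
  have h2 : (expand F m ((X - 1 : F[X]) ^ t)).support ⊆
      ((X - 1 : F[X]) ^ t).support.image (· * m) := by
    intro x hx
    rw [mem_support_iff, coeff_expand hm] at hx
    split_ifs at hx with hd
    · exact Finset.mem_image.mpr ⟨x / m, mem_support_iff.mpr hx, Nat.div_mul_cancel hd⟩
    · exact absurd rfl hx
  rw [h1]
  calc _ ≤ _ := Finset.card_le_card h2
    _ ≤ ((X - 1 : F[X]) ^ t).support.card := Finset.card_image_le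
    _ ≤ ((X - 1 : F[X]) ^ t).natDegree + 1 := card_supp_le_succ_natDegree _
    _ = t + 1 := by
      have : (X - 1 : F[X]).natDegree = 1 := by simpa using natDegree_X_sub_C (1 : F)
      rw [natDegree_pow, this, mul_one]

/-- `(X ^ (p ^ (e + 1)) - 1) ^ (p ^ k - 1) * (X ^ (p ^ e) - 1) ^ (p - a)` with `k = s - 1 - e` is
the power of `X - 1` with exponent `p ^ s - a * p ^ e`, and it has few terms. -/
theorem card_support_X_sub_one_pow_le (p : ℕ) [Fact p.Prime] [CharP F p] {s e a : ℕ} (he : e < s)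
    (hap : a ≤ p) :
    ((X - 1 : F[X]) ^ (p ^ s - a * p ^ e)).support.card ≤ (p + 1 - a) * p ^ (s - 1 - e) := by
  have hp := (Fact.out : p.Prime)
  obtain ⟨k, rfl⟩ : ∃ k, s = e + 1 + k := ⟨s - (e + 1), by omega⟩
  have hk : 1 ≤ p ^ k := Nat.one_le_pow _ _ hp.pos
  have hexp : p ^ (e + 1 + k) - a * p ^ e = p ^ (e + 1) * (p ^ k - 1) + p ^ e * (p - a) := by
    obtain ⟨b, rfl⟩ : ∃ b, p = a + b := ⟨p - a, by omega⟩
    obtain ⟨c, hc⟩ : ∃ c, (a + b) ^ k = c + 1 := ⟨(a + b) ^ k - 1, by omega⟩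
    rw [pow_add _ (e + 1), hc, Nat.add_sub_cancel, Nat.add_sub_cancel_left]
    refine Nat.sub_eq_of_eq_add ?_
    rw [pow_succ]
    ring
  have hfac : (X - 1 : F[X]) ^ (p ^ (e + 1 + k) - a * p ^ e) =
      (X ^ p ^ (e + 1) - 1) ^ (p ^ k - 1) * (X ^ p ^ e - 1) ^ (p - a) := by
    rw [X_pow_sub_one_eq_pow, X_pow_sub_one_eq_pow, ← pow_mul, ← pow_mul, ← pow_add, hexp]
  rw [hfac]
  calc _ ≤ _ := card_support_mul_le
    _ ≤ (p ^ k - 1 + 1) * (p - a + 1) := Nat.mul_le_mul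
        (card_support_X_pow_sub_one_pow_le (pow_pos hp.pos _) _)
        (card_support_X_pow_sub_one_pow_le (pow_pos hp.pos _) _)
    _ = _ := by
      rw [show e + 1 + k - 1 - e = k by omega, Nat.sub_add_cancel hk, mul_comm]
      congr 1
      omega

end Weights

/-! ### The codes as spaces of polynomials -/

section Codes

variable {F : Type*} [Field F] {n i : ℕ}

/-- The polynomial `c_0 + c_1 X + ⋯ + c_{n-1} X ^ (n-1)` of a vector. -/
noncomputable def vecPoly (F : Type*) [Field F] (n : ℕ) : (Fin n → F) →ₗ[F] F[X] :=
  ∑ j : Fin n, (monomial (j : ℕ) : F →ₗ[F] F[X]) ∘ₗ LinearMap.proj j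

theorem vecPoly_apply (c : Fin n → F) : vecPoly F n c = ∑ j : Fin n, monomial (j : ℕ) (c j) := by
  simp [vecPoly]

theorem coeff_vecPoly (c : Fin n → F) (m : ℕ) :
    (vecPoly F n c).coeff m = if h : m < n then c ⟨m, h⟩ else 0 := by
  rw [vecPoly_apply, finsetSum_coeff]
  simp only [coeff_monomial]
  split_ifs with h
  · rw [Finset.sum_eq_single ⟨m, h⟩]
    · simp
    · intro b _ hb
      rw [if_neg]
      rintro rfl
      exact hb rfl
    · simp
  · refine Finset.sum_eq_zero fun b _ => if_neg ?_
    have := b.2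
    omega

theorem coeff_vecPoly_fin (c : Fin n → F) (j : Fin n) : (vecPoly F n c).coeff j = c j := by
  rw [coeff_vecPoly, dif_pos j.2]

theorem degree_vecPoly_lt (c : Fin n → F) : (vecPoly F n c).degree < n := by
  rw [degree_lt_iff_coeff_zero]
  intro m hm
  rw [coeff_vecPoly, dif_neg (by omega)]

theorem vecPoly_injective : Function.Injective (vecPoly F n) := fun c c' h => by
  funext j
  rw [← coeff_vecPoly_fin c, h, coeff_vecPoly_fin]

theorem vecPoly_coeff {f : F[X]} (hf : f.degree < n) :
    vecPoly F n (fun j => f.coeff j) = f := by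
  ext m
  rw [coeff_vecPoly]
  split_ifs with h
  · rfl
  · exact ((degree_lt_iff_coeff_zero f n).mp hf m (by omega)).symm

theorem card_support_vecPoly [DecidableEq F] (c : Fin n → F) :
    (vecPoly F n c).support.card = hammingNorm c := by
  rw [hammingNorm, ← Finset.card_map Fin.valEmbedding]
  congr 1
  ext m
  simp only [mem_support_iff, coeff_vecPoly, Finset.mem_map, Finset.mem_filter, Finset.mem_univ,
    true_and, Fin.valEmbedding_apply]
  constructor
  · intro h
    by_cases hm : m < n
    · exact ⟨⟨m, hm⟩, by simpa [hm] using h, rfl⟩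
    · simp [hm] at h
  · rintro ⟨j, hj, rfl⟩
    simpa using hj

theorem degree_X_sub_one_pow (i : ℕ) : ((X - 1 : F[X]) ^ i).degree = i := by
  have h : (X - 1 : F[X]).degree = 1 := by simpa using degree_X_sub_C (1 : F)
  rw [degree_pow, h, nsmul_one]

/-- Since `X ^ n - 1 = (X - 1) ^ n`, membership in the ideal of the quotient ring is
divisibility by `(X - 1) ^ i` in `F[X]`. -/
theorem mem_rootOneCode_iff (hn : (X ^ n - 1 : F[X]) = (X - 1) ^ n) (hi : i ≤ n)
    (c : Fin n → F) : c ∈ rootOneCode F n i ↔ (X - 1 : F[X]) ^ i ∣ vecPoly F n c := by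
  have hle : Ideal.span {(X ^ n - 1 : F[X])} ≤ Ideal.span {((X - 1 : F[X]) ^ i)} := by
    rw [Ideal.span_singleton_le_span_singleton, hn]
    exact pow_dvd_pow _ hi
  have hmk : vecToQuotient F n c =
      Ideal.Quotient.mk (Ideal.span {(X ^ n - 1 : F[X])}) (vecPoly F n c) := rfl
  have hmap : Ideal.span {Ideal.Quotient.mk (Ideal.span {(X ^ n - 1 : F[X])}) ((X - 1) ^ i)} =
      (Ideal.span {((X - 1 : F[X]) ^ i)}).map
        (Ideal.Quotient.mk (Ideal.span {(X ^ n - 1 : F[X])})) := by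
    rw [Ideal.map_span, Set.image_singleton]
  rw [rootOneCode, Submodule.mem_comap, Submodule.restrictScalars_mem, hmk, hmap,
    Ideal.mem_quotient_iff_mem hle, Ideal.mem_span_singleton]

theorem isCyclicCode_rootOneCode (hn : (X ^ n - 1 : F[X]) = (X - 1) ^ n) (hi : i ≤ n) :
    IsCyclicCode (rootOneCode F n i) := by
  rcases n with _ | N
  · intro c hc
    rwa [Subsingleton.elim (fun j => c ((finRotate 0).symm j)) c]
  intro c hc
  rw [mem_rootOneCode_iff hn hi] at hc ⊢
  have hshift : vecPoly F (N + 1) (fun j => c ((finRotate (N + 1)).symm j)) =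
      X * vecPoly F (N + 1) c - C (c (Fin.last N)) * (X ^ (N + 1) - 1) := by
    have hzero : (finRotate (N + 1)).symm 0 = Fin.last N := by
      rw [Equiv.symm_apply_eq, finRotate_last]
    have hsucc : ∀ (m : ℕ) (hm : m + 1 < N + 1),
        (finRotate (N + 1)).symm ⟨m + 1, hm⟩ = ⟨m, by omega⟩ := by
      intro m hm
      rw [Equiv.symm_apply_eq, finRotate_of_lt (by omega)]
    ext m
    rcases m with _ | m
    · rw [coeff_vecPoly, dif_pos N.succ_pos, show (⟨0, N.succ_pos⟩ : Fin (N + 1)) = 0 from rfl,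
        hzero]
      simp
    · rw [coeff_sub, coeff_X_mul, coeff_C_mul, coeff_sub, coeff_X_pow, coeff_one,
        if_neg (Nat.succ_ne_zero m), coeff_vecPoly, coeff_vecPoly]
      rcases lt_trichotomy m N with h | rfl | h
      · rw [dif_pos (by omega), dif_pos (by omega), if_neg (by omega), hsucc]
        simp
      · rw [dif_neg (by omega), dif_pos (by omega), if_pos rfl]
        simp [Fin.last]
      · rw [dif_neg (by omega), dif_neg (by omega), if_neg (by omega)]
        simp
  rw [hshift]
  refine dvd_sub (hc.mul_left _) (Dvd.dvd.mul_left ?_ _)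
  rw [hn]
  exact pow_dvd_pow _ hi

theorem finrank_rootOneCode (hn : (X ^ n - 1 : F[X]) = (X - 1) ^ n) (hi : i ≤ n) :
    Module.finrank F (rootOneCode F n i) = n - i := by
  have hX : (X - 1 : F[X]) ^ i ≠ 0 := pow_ne_zero _ (by simpa using X_sub_C_ne_zero (1 : F))
  -- the vector of coefficients of `(X - 1) ^ i * u` for `u` of degree below `n - i`
  let φ : (Fin (n - i) → F) →ₗ[F] (Fin n → F) :=
    LinearMap.pi fun j => lcoeff F j ∘ₗ LinearMap.mulLeft F ((X - 1 : F[X]) ^ i) ∘ₗ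
      vecPoly F (n - i)
  have hφ : ∀ u, vecPoly F n (φ u) = (X - 1) ^ i * vecPoly F (n - i) u := by
    intro u
    have hdeg : ((X - 1 : F[X]) ^ i * vecPoly F (n - i) u).degree < (n : WithBot ℕ) := by
      rw [degree_mul, degree_X_sub_one_pow]
      calc ((i : ℕ) : WithBot ℕ) + (vecPoly F (n - i) u).degree
          < (i : ℕ) + ((n - i : ℕ) : WithBot ℕ) :=
            WithBot.add_lt_add_left (WithBot.natCast_ne_bot i) (degree_vecPoly_lt u)
        _ = n := by
            rw [← Nat.cast_add]
            congr 1
            omega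
    exact vecPoly_coeff hdeg
  have hinj : Function.Injective φ := by
    intro u u' h
    have := congrArg (vecPoly F n) h
    rw [hφ, hφ] at this
    exact vecPoly_injective (mul_left_cancel₀ hX this)
  have hrange : LinearMap.range φ = rootOneCode F n i := by
    ext c
    rw [mem_rootOneCode_iff hn hi, LinearMap.mem_range]
    constructor
    · rintro ⟨u, rfl⟩
      exact ⟨_, hφ u⟩
    · rintro ⟨w, hw⟩
      have hwdeg : w.degree < (n - i : ℕ) := by
        by_cases hw0 : w = 0
        · simp [hw0]
        have h1 := degree_vecPoly_lt c
        rw [hw, degree_mul, degree_X_sub_one_pow, degree_eq_natDegree hw0] at h1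
        rw [degree_eq_natDegree hw0]
        have h2 : i + w.natDegree < n := by exact_mod_cast h1
        exact_mod_cast (by omega : w.natDegree < n - i)
      refine ⟨fun j => w.coeff j, vecPoly_injective ?_⟩
      rw [hφ, vecPoly_coeff hwdeg, hw]
  rw [← hrange, LinearMap.finrank_range_of_inj hinj, Module.finrank_fin_fun]

open Classical in
theorem isMinDistance_of_hammingNorm {C : Submodule F (Fin n → F)} {d : ℕ} (hd : 1 ≤ d)
    (hle : ∀ c ∈ C, c ≠ 0 → d ≤ hammingNorm c) (hex : ∃ c ∈ C, hammingNorm c = d) :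
    IsMinDistance C d := by
  constructor
  · obtain ⟨c, hc, hcd⟩ := hex
    refine ⟨c, hc, 0, C.zero_mem, ?_, by rw [hammingDist_zero_right, hcd]⟩
    rintro rfl
    rw [hammingNorm_zero] at hcd
    omega
  · rintro w ⟨x, hx, y, hy, hxy, rfl⟩
    rw [hammingDist_eq_hammingNorm, neg_add_eq_sub]
    exact hle _ (C.sub_mem hy hx) (sub_ne_zero.mpr hxy.symm)

open Classical in
theorem IsMinDistance.le_hammingNorm {C : Submodule F (Fin n → F)} {d : ℕ}
    (h : IsMinDistance C d) {c : Fin n → F} (hc : c ∈ C) (hc0 : c ≠ 0) : d ≤ hammingNorm c :=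
  h.2 ⟨c, hc, 0, C.zero_mem, hc0, hammingDist_zero_right c⟩

open Classical in
theorem IsMinDistance.exists_hammingNorm_eq {C : Submodule F (Fin n → F)} {d : ℕ}
    (h : IsMinDistance C d) : ∃ c ∈ C, c ≠ 0 ∧ hammingNorm c = d := by
  obtain ⟨x, hx, y, hy, hxy, hd⟩ := h.1
  exact ⟨y - x, C.sub_mem hy hx, sub_ne_zero.mpr hxy.symm,
    by rw [← neg_add_eq_sub, ← hammingDist_eq_hammingNorm, hd]⟩

/-- The minimum distance of `⟨(X - 1) ^ i⟩`, in terms of the leading base-`p` digit `a` of the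
dimension `j` and its position `e`. -/
theorem isMinDistance_rootOneCode (p : ℕ) [Fact p.Prime] [CharP F p] {s i j a e : ℕ}
    (hij : i + j = p ^ s) (he : e < s) (ha : 1 ≤ a) (hap : a < p) (haj : a * p ^ e ≤ j)
    (hja : j < (a + 1) * p ^ e) :
    IsMinDistance (rootOneCode F (p ^ s) i) ((p + 1 - a) * p ^ (s - 1 - e)) := by
  classical
  have hp := (Fact.out : p.Prime)
  have hn := X_pow_sub_one_eq_pow (F := F) p s
  have hi : i ≤ p ^ s := by omega
  have hle : ∀ c ∈ rootOneCode F (p ^ s) i, c ≠ 0 →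
      (p + 1 - a) * p ^ (s - 1 - e) ≤ hammingNorm c := by
    intro c hc hc0
    rw [mem_rootOneCode_iff hn hi] at hc
    have hf0 : vecPoly F (p ^ s) c ≠ 0 := fun h =>
      hc0 (vecPoly_injective (h.trans (map_zero _).symm))
    rw [← card_support_vecPoly]
    exact le_card_support_of_pow_dvd p s e a j i _ hij he ha hap hja hf0
      ((natDegree_lt_iff_degree_lt hf0).mpr (degree_vecPoly_lt c)) hc
  have hpos : 1 ≤ a * p ^ e := Nat.mul_pos ha (pow_pos hp.pos e)
  refine isMinDistance_of_hammingNorm (Nat.mul_pos (by omega) (pow_pos hp.pos _)) hle ?_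
  set w : F[X] := (X - 1) ^ (p ^ s - a * p ^ e) with hw
  have hwdeg : w.degree < (p ^ s : ℕ) := by
    rw [hw, degree_X_sub_one_pow]
    exact_mod_cast (by omega : p ^ s - a * p ^ e < p ^ s)
  have hw0 : w ≠ 0 := pow_ne_zero _ (by simpa using X_sub_C_ne_zero (1 : F))
  have hwv := vecPoly_coeff hwdeg
  have hmem : (fun j : Fin (p ^ s) => w.coeff j) ∈ rootOneCode F (p ^ s) i := by
    rw [mem_rootOneCode_iff hn hi, hwv]
    exact pow_dvd_pow _ (by omega)
  refine ⟨_, hmem, le_antisymm ?_ (hle _ hmem ?_)⟩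
  · rw [← card_support_vecPoly, hwv]
    exact card_support_X_sub_one_pow_le p he hap.le
  · intro h0
    rw [h0, map_zero] at hwv
    exact hw0 hwv.symm

/-! ### Locality and the dual code -/

theorem coeff_vecPoly_mul_vecPoly_rev (v c : Fin n → F) :
    (vecPoly F n c * vecPoly F n (fun j => v j.rev)).coeff (n - 1) = ∑ j, v j * c j := by
  rcases n with _ | N
  · simp [vecPoly_apply]
  rw [Nat.add_sub_cancel, coeff_mul, Finset.Nat.sum_antidiagonal_eq_sum_range_succ_mk,
    Finset.sum_range]
  refine Finset.sum_congr rfl fun j _ => ?_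
  have hj := j.2
  rw [coeff_vecPoly_fin, coeff_vecPoly, dif_pos (by omega), mul_comm]
  congr 2
  ext
  simp [Fin.val_rev]
  omega

/-- The dual of `⟨(X - 1) ^ i⟩` is the reversal of `⟨(X - 1) ^ (n - i)⟩`: the inner product of `v`
and `c` is the coefficient of `X ^ (n - 1)` in the product of the polynomial of `c` and that of
the reversal of `v`. -/
theorem rev_mem_rootOneCode_iff (hn : (X ^ n - 1 : F[X]) = (X - 1) ^ n) {j : ℕ}
    (hij : i + j = n) (v : Fin n → F) :
    (fun m => v (Fin.rev m)) ∈ rootOneCode F n j ↔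
      ∀ c ∈ rootOneCode F n i, ∑ m, v m * c m = 0 := by
  rcases Nat.eq_zero_or_pos n with rfl | hn0
  · obtain ⟨rfl, rfl⟩ : i = 0 ∧ j = 0 := by omega
    simp [mem_rootOneCode_iff hn le_rfl]
  have hi : i ≤ n := by omega
  have hX0 : (X - 1 : F[X]) ≠ 0 := by simpa using X_sub_C_ne_zero (1 : F)
  have hXi : (X - 1 : F[X]) ^ i ≠ 0 := pow_ne_zero _ hX0
  rw [mem_rootOneCode_iff hn (by omega)]
  set V := vecPoly F n (fun m => v (Fin.rev m)) with hV
  have hVdeg : V.degree < n := degree_vecPoly_lt _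
  constructor
  · rintro ⟨w, hw⟩ c hc
    rw [mem_rootOneCode_iff hn hi] at hc
    obtain ⟨u, hu⟩ := hc
    rw [← coeff_vecPoly_mul_vecPoly_rev, ← hV]
    have hprod : vecPoly F n c * V = X ^ n * (u * w) - u * w := by
      rw [hw, hu, show (X - 1 : F[X]) ^ i * u * ((X - 1) ^ j * w) =
        (X - 1) ^ (i + j) * (u * w) by ring, hij, ← hn]
      ring
    by_cases huw : u * w = 0
    · rw [hprod, huw]; simp
    have hVne : V ≠ 0 := by
      intro h0
      rw [h0, zero_eq_mul, or_iff_right (pow_ne_zero _ hX0)] at hw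
      rw [hw, mul_zero] at huw
      exact huw rfl
    have hcne : vecPoly F n c ≠ 0 := by
      intro h0
      rw [h0, zero_eq_mul, or_iff_right hXi] at hu
      rw [hu, zero_mul] at huw
      exact huw rfl
    have hdeg : (u * w).natDegree < n - 1 := by
      have h1 : (vecPoly F n c * V).natDegree = n + (u * w).natDegree := by
        rw [show vecPoly F n c * V = (X - 1) ^ n * (u * w) by rw [hprod, ← hn]; ring,
          natDegree_mul (pow_ne_zero _ hX0) huw]
        congr 1
        exact natDegree_eq_of_degree_eq_some (degree_X_sub_one_pow n)
      rw [natDegree_mul hcne hVne] at h1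
      have h2 := (natDegree_lt_iff_degree_lt hVne).mpr hVdeg
      have h3 := (natDegree_lt_iff_degree_lt hcne).mpr (degree_vecPoly_lt c)
      omega
    rw [hprod, coeff_sub, coeff_X_pow_mul', if_neg (by omega), coeff_eq_zero_of_natDegree_lt hdeg,
      sub_zero]
  · intro horth
    set P := (X - 1 : F[X]) ^ i * V with hP
    -- orthogonality to the coefficient vectors of `(X - 1) ^ i * X ^ m`
    have hcoeff : ∀ m, i ≤ m → m < n → P.coeff m = 0 := by
      intro m him hmn
      have hdeg : ((X - 1 : F[X]) ^ i * X ^ (n - 1 - m)).degree < (n : WithBot ℕ) := by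
        rw [degree_mul, degree_X_sub_one_pow, degree_X_pow]
        exact_mod_cast (by omega : i + (n - 1 - m) < n)
      have hv := vecPoly_coeff hdeg
      have h0 := horth (fun m' => ((X - 1 : F[X]) ^ i * X ^ (n - 1 - m)).coeff m') (by
        rw [mem_rootOneCode_iff hn hi, hv]
        exact dvd_mul_right _ _)
      rw [← coeff_vecPoly_mul_vecPoly_rev, hv, ← hV,
        show (X - 1 : F[X]) ^ i * X ^ (n - 1 - m) * V = X ^ (n - 1 - m) * P by rw [hP]; ring,
        show (n - 1) = m + (n - 1 - m) by omega, Nat.add_sub_cancel_left, coeff_X_pow_mul] at h0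
      exact h0
    have hXn : (X ^ n - 1 : F[X]).Monic := by simpa using monic_X_pow_sub_C (1 : F) hn0.ne'
    -- splitting `P = A + X ^ n * B` at the exponent `n`
    set A : F[X] := P %ₘ X ^ n with hA
    set B : F[X] := P /ₘ X ^ n with hB
    have hAB : A + X ^ n * B = P := modByMonic_add_div P (X ^ n)
    have hAn : A.degree < n := by
      have := degree_modByMonic_lt P (monic_X_pow (R := F) n)
      rwa [degree_X_pow] at this
    have hAdeg : A.degree < i := by
      rw [degree_lt_iff_coeff_zero]
      intro m hm
      by_cases hmn : m < n
      · have := congrArg (coeff · m) hAB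
        simp only [coeff_add, coeff_X_pow_mul', if_neg (by omega : ¬ n ≤ m), add_zero] at this
        rw [this, hcoeff m hm hmn]
      · exact (degree_lt_iff_coeff_zero A n).mp hAn m (by omega)
    have hBdeg : B.degree < i := by
      rw [degree_lt_iff_coeff_zero]
      intro m hm
      have h1 := congrArg (coeff · (m + n)) hAB
      simp only [coeff_add, coeff_X_pow_mul] at h1
      rw [(degree_lt_iff_coeff_zero A n).mp hAn _ (by omega), zero_add] at h1
      rw [h1]
      refine coeff_eq_zero_of_degree_lt ?_
      rw [hP, degree_mul, degree_X_sub_one_pow]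
      calc ((i : ℕ) : WithBot ℕ) + V.degree < (i : ℕ) + (n : WithBot ℕ) :=
            WithBot.add_lt_add_left (WithBot.natCast_ne_bot i) hVdeg
        _ ≤ ((m + n : ℕ) : WithBot ℕ) := by exact_mod_cast (by omega : i + n ≤ m + n)
    have hsum : A + B = 0 := by
      have hd : (X - 1 : F[X]) ^ i ∣ A + B := by
        have : A + B = P - (X - 1) ^ n * B := by rw [← hAB, ← hn]; ring
        rw [this]
        exact dvd_sub (dvd_mul_right _ _) ((pow_dvd_pow _ hi).mul_right _)
      refine eq_zero_of_dvd_of_degree_lt hd ?_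
      rw [degree_X_sub_one_pow]
      exact (degree_add_le _ _).trans_lt (max_lt hAdeg hBdeg)
    refine ⟨B, mul_left_cancel₀ hXi ?_⟩
    rw [← mul_assoc, ← pow_add, hij, ← hn, ← hP, ← hAB, eq_neg_of_add_eq_zero_left hsum]
    ring

open Classical in
/-- A nonzero word of a cyclic code has a cyclic shift that is nonzero at a prescribed position. -/
theorem IsCyclicCode.exists_hammingNorm_eq_of_ne_zero {C : Submodule F (Fin n → F)}
    (hC : IsCyclicCode C) {c : Fin n → F} (hc : c ∈ C) (hc0 : c ≠ 0) (j : Fin n) :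
    ∃ c' ∈ C, hammingNorm c' = hammingNorm c ∧ c' j ≠ 0 := by
  have hiter : ∀ m : ℕ, (fun x => c (((finRotate n).symm ^ m) x)) ∈ C := by
    intro m
    induction m with
    | zero => simpa using hc
    | succ m ih =>
      have := hC _ ih
      simpa only [pow_succ, Equiv.Perm.mul_apply] using this
  have hnorm : ∀ σ : Equiv.Perm (Fin n), hammingNorm (fun x => c (σ x)) = hammingNorm c := by
    intro σ
    unfold hammingNorm
    exact Finset.card_equiv σ (by simp)
  obtain ⟨j₀, hj₀⟩ : ∃ j₀, c j₀ ≠ 0 := Function.ne_iff.mp hc0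
  rcases n with _ | N
  · exact j.elim0
  have hrot : ∀ (m : ℕ) (x : Fin (N + 1)),
      (((finRotate (N + 1)) ^ m) x).val = (x.val + m) % (N + 1) := by
    intro m x
    induction m with
    | zero => simp [Nat.mod_eq_of_lt x.2]
    | succ m ih =>
      rw [pow_succ', Equiv.Perm.mul_apply, finRotate_apply, Fin.val_add, ih, Fin.val_one',
        ← Nat.add_mod, add_assoc]
  refine ⟨_, hiter (j.val + (N + 1) - j₀.val), hnorm _, ?_⟩
  have : ((finRotate (N + 1)).symm ^ (j.val + (N + 1) - j₀.val)) j = j₀ := by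
    rw [← Equiv.Perm.inv_def, inv_pow, Equiv.Perm.inv_eq_iff_eq]
    ext
    rw [hrot, show j₀.val + (j.val + (N + 1) - j₀.val) = j.val + (N + 1) by omega,
      Nat.add_mod_right, Nat.mod_eq_of_lt j.2]
  simpa only [this] using hj₀

open Classical in
/-- Repair sets of the symbol `j` are the supports, with `j` removed, of the dual words that are
nonzero at `j`. -/
theorem exists_isRepairSet_card_iff (C : Submodule F (Fin n → F)) (j : Fin n) (m : ℕ) :
    (∃ S, IsRepairSet C j S ∧ S.card = m) ↔
      ∃ v : Fin n → F, v j ≠ 0 ∧ hammingNorm v = m + 1 ∧ ∀ c ∈ C, ∑ t, v t * c t = 0 := by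
  constructor
  · rintro ⟨S, ⟨hjS, a, ha, hrep⟩, rfl⟩
    refine ⟨fun t => if t = j then -1 else if t ∈ S then a t else 0, by simp, ?_, ?_⟩
    · rw [hammingNorm, ← Finset.card_insert_of_notMem hjS]
      congr 1
      ext t
      simp only [Finset.mem_filter, Finset.mem_univ, true_and, Finset.mem_insert]
      by_cases h1 : t = j
      · simp [h1]
      · by_cases h2 : t ∈ S
        · simp [h1, h2, ha t h2]
        · simp [h1, h2]
    · intro c hc
      have hterm : ∀ t, (if t = j then (-1 : F) else if t ∈ S then a t else 0) * c t =
          (if t = j then -c t else 0) + if t ∈ S then a t * c t else 0 := by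
        intro t
        by_cases h1 : t = j
        · subst h1; simp [hjS]
        · by_cases h2 : t ∈ S <;> simp [h1, h2]
      rw [Finset.sum_congr rfl fun t _ => hterm t, Finset.sum_add_distrib]
      simp only [Finset.sum_ite_eq', Finset.mem_univ, if_true, Finset.sum_ite_mem,
        Finset.univ_inter]
      rw [hrep c hc]
      ring
  · rintro ⟨v, hvj, hnorm, horth⟩
    set T : Finset (Fin n) := Finset.univ.filter fun t => v t ≠ 0 with hT
    have hjT : j ∈ T := by simp [hT, hvj]
    have hcard : T.card = m + 1 := hnorm
    refine ⟨T.erase j, ⟨Finset.notMem_erase _ _, fun t => -(v t / v j), ?_, ?_⟩, ?_⟩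
    · intro t ht
      have : v t ≠ 0 := by simpa [hT] using Finset.mem_of_mem_erase ht
      exact neg_ne_zero.mpr (div_ne_zero this hvj)
    · intro c hc
      have h1 : ∑ t, v t * c t = ∑ t ∈ T, v t * c t := by
        refine (Finset.sum_subset (Finset.subset_univ T) fun t _ ht => ?_).symm
        have : v t = 0 := by simpa [hT] using ht
        rw [this, zero_mul]
      have h2 := horth c hc
      rw [h1, ← Finset.add_sum_erase T _ hjT] at h2
      have h3 : ∑ t ∈ T.erase j, -(v t / v j) * c t = -(∑ t ∈ T.erase j, v t * c t) / v j := by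
        rw [neg_div, Finset.sum_div, ← Finset.sum_neg_distrib]
        exact Finset.sum_congr rfl fun t _ => by ring
      rw [h3, eq_div_iff hvj]
      linear_combination h2
    · rw [Finset.card_erase_of_mem hjT, hcard, Nat.add_sub_cancel]

/-- The locality of every symbol is one less than the minimum distance of the dual code. -/
theorem hasSymbolLocality_rootOneCode (hn : (X ^ n - 1 : F[X]) = (X - 1) ^ n) {j r : ℕ}
    (hij : i + j = n) (hd : IsMinDistance (rootOneCode F n j) (r + 1)) (t : Fin n) :
    HasSymbolLocality (rootOneCode F n i) t r := by
  classical
  have hrevnorm : ∀ v : Fin n → F, hammingNorm (fun m => v (Fin.rev m)) = hammingNorm v := by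
    intro v
    unfold hammingNorm
    exact Finset.card_equiv Fin.revPerm (by simp)
  constructor
  · obtain ⟨c, hc, hc0, hcn⟩ := hd.exists_hammingNorm_eq
    obtain ⟨c', hc', hcn', hne⟩ := (isCyclicCode_rootOneCode hn
      (by omega : j ≤ n)).exists_hammingNorm_eq_of_ne_zero hc hc0 t.rev
    refine (exists_isRepairSet_card_iff _ t r).mpr
      ⟨fun m => c' m.rev, hne, by rw [hrevnorm, hcn']; convert hcn, ?_⟩
    rw [← rev_mem_rootOneCode_iff hn hij]
    simpa using hc'
  · intro m hm
    obtain ⟨v, hvt, hvn, horth⟩ := (exists_isRepairSet_card_iff _ t m).mp hm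
    have hmem := (rev_mem_rootOneCode_iff hn hij v).mpr horth
    have := hd.le_hammingNorm hmem (fun h0 => hvt (by simpa using congrFun h0 t.rev))
    have h2 : hammingNorm (fun m => v (Fin.rev m)) = m + 1 := by rw [hrevnorm, hvn]
    have h3 : r + 1 ≤ m + 1 := h2 ▸ (by convert this)
    omega

theorem hasLocality_iff_of_forall {C : Submodule F (Fin n → F)} {r r' : ℕ} (hn : 0 < n)
    (h : ∀ t, HasSymbolLocality C t r) : HasLocality C r' ↔ r' = r := by
  constructor
  · rintro ⟨ρ, hρ, ⟨t, rfl⟩, _⟩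
    exact (hρ t).unique (h t)
  · rintro rfl
    refine ⟨fun _ => r', h, ⟨⟨0, hn⟩, rfl⟩, ?_⟩
    rintro _ ⟨t, rfl⟩
    exact le_rfl

/-- With `a` at position `e` the leading digit of the dimension `j`, and `b` at position `g` that of
the redundancy `i`, being an optimal locally repairable code is an arithmetic condition. The
condition `1 ≤ r` holds automatically, as the dual distance is at least `2`. -/
theorem isOptimalCyclicLRC_rootOneCode_iff (p : ℕ) [Fact p.Prime] [CharP F p]
    {s i j a e b g : ℕ} (hij : i + j = p ^ s) (he : e < s) (ha : 1 ≤ a) (hap : a < p)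
    (haj : a * p ^ e ≤ j) (hja : j < (a + 1) * p ^ e) (hg : g < s) (hb : 1 ≤ b) (hbp : b < p)
    (hbi : b * p ^ g ≤ i) (hib : i < (b + 1) * p ^ g) {k d r : ℕ} :
    IsOptimalCyclicLRC (rootOneCode F (p ^ s) i) k d r ↔
      k = j ∧ d = (p + 1 - a) * p ^ (s - 1 - e) ∧ r + 1 = (p + 1 - b) * p ^ (s - 1 - g) ∧
        (i : ℤ) = ⌈(j : ℚ) / (r : ℚ)⌉ + d - 2 := by
  have hp := (Fact.out : p.Prime)
  have hn := X_pow_sub_one_eq_pow (F := F) p s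
  have hi : i ≤ p ^ s := by omega
  have hmin := isMinDistance_rootOneCode (F := F) p hij he ha hap haj hja
  have hmin' := isMinDistance_rootOneCode (F := F) p (by omega : j + i = p ^ s) hg hb hbp hbi hib
  have htwo : 2 ≤ (p + 1 - b) * p ^ (s - 1 - g) := by
    calc 2 = 2 * 1 := rfl
      _ ≤ _ := Nat.mul_le_mul (by omega) (Nat.one_le_pow _ _ hp.pos)
  have hcast : ((p ^ s : ℕ) : ℤ) - j = i := by omega
  obtain ⟨r₀, hr₀⟩ : ∃ r₀, r₀ + 1 = (p + 1 - b) * p ^ (s - 1 - g) :=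
    ⟨_, Nat.sub_add_cancel (by omega)⟩
  rw [← hr₀] at hmin' htwo
  have hloc := hasLocality_iff_of_forall (r' := r) (pow_pos hp.pos s)
    (hasSymbolLocality_rootOneCode hn hij hmin')
  constructor
  · rintro ⟨-, hk, hd, hr, -, hopt⟩
    rw [finrank_rootOneCode hn hi] at hk
    obtain rfl : k = j := by omega
    obtain rfl := hloc.mp hr
    exact ⟨rfl, hd.unique hmin, hr₀, by rw [← hcast, hopt]⟩
  · rintro ⟨rfl, rfl, hr, hopt⟩
    obtain rfl : r = r₀ := by omega
    exact ⟨isCyclicCode_rootOneCode hn hi, by rw [finrank_rootOneCode hn hi]; omega, hmin,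
      hloc.mpr rfl, by omega, by rw [hcast, hopt]⟩

end Codes

/-! ### Parameters of the optimal codes -/

section Families

variable {F : Type*} [Field F]

/-- The optimality condition without the ceiling. The quotient `⌈j / r⌉` is `i + 2 - d`. -/
theorem redundancy_eq_ceil_iff {i j d r : ℕ} (hr : 0 < r) :
    (i : ℤ) = ⌈(j : ℚ) / (r : ℚ)⌉ + d - 2 ↔
      ((i : ℤ) + 1 - d) * r < j ∧ (j : ℤ) ≤ ((i : ℤ) + 2 - d) * r := by
  have hr' : (0 : ℚ) < r := by exact_mod_cast hr
  have h1 : (i : ℤ) = ⌈(j : ℚ) / (r : ℚ)⌉ + d - 2 ↔ ⌈(j : ℚ) / (r : ℚ)⌉ = (i : ℤ) + 2 - d := by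
    omega
  rw [h1, Int.ceil_eq_iff, lt_div_iff₀ hr', div_le_iff₀ hr']
  have h2 : (((i : ℤ) + 2 - d : ℤ) : ℚ) - 1 = (((i : ℤ) + 1 - d : ℤ) : ℚ) := by push_cast; ring
  rw [h2]
  exact_mod_cast Iff.rfl

theorem exists_leading_digit {p : ℕ} (hp : 1 < p) {s j : ℕ} (hj : 1 ≤ j) (hjs : j < p ^ s) :
    ∃ e a, e < s ∧ 1 ≤ a ∧ a < p ∧ a * p ^ e ≤ j ∧ j < (a + 1) * p ^ e := by
  have hpos : 0 < p ^ Nat.log p j := pow_pos (by omega) _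
  have h1 : p ^ Nat.log p j ≤ j := Nat.pow_log_le_self p (by omega)
  have h2 : j < p ^ (Nat.log p j + 1) := Nat.lt_pow_succ_log_self hp j
  refine ⟨Nat.log p j, j / p ^ Nat.log p j, ?_, ?_, ?_, Nat.div_mul_le_self _ _, ?_⟩
  · exact (Nat.pow_lt_pow_iff_right hp).mp (h1.trans_lt hjs)
  · exact (Nat.one_le_div_iff hpos).mpr h1
  · rw [Nat.div_lt_iff_lt_mul hpos, mul_comm]
    rwa [pow_succ] at h2
  · rw [mul_comm]
    exact Nat.lt_mul_div_succ j hpos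

variable (p : ℕ) [Fact p.Prime] [CharP F p]

theorem isOptimalCyclicLRC_two_pow (hp2 : p = 2) {s : ℕ} (hs : 2 ≤ s) :
    IsOptimalCyclicLRC (rootOneCode F (2 ^ s) (2 ^ (s - 1) + 1)) (2 ^ (s - 1) - 1) 4 1 := by
  subst hp2
  obtain ⟨S, rfl⟩ : ∃ S, s = S + 2 := ⟨s - 2, by omega⟩
  have h0 : 1 ≤ 2 ^ S := Nat.one_le_two_pow
  have h1 : 2 ^ (S + 1) = 2 * 2 ^ S := by rw [pow_succ, mul_comm]
  have h2 : 2 ^ (S + 2) = 2 * (2 * 2 ^ S) := by rw [pow_succ, h1, mul_comm]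
  rw [show S + 2 - 1 = S + 1 by omega]
  refine (isOptimalCyclicLRC_rootOneCode_iff 2 (a := 1) (e := S) (b := 1) (g := S + 1)
    (j := 2 ^ (S + 1) - 1) (by omega) (by omega) le_rfl (by omega) (by omega) (by omega)
    (by omega) le_rfl (by omega) (by omega) (by omega)).mpr ⟨rfl, ?_, ?_, ?_⟩
  · rw [show S + 2 - 1 - S = 1 by omega]
    rfl
  · rw [show S + 2 - 1 - (S + 1) = 0 by omega]
    rfl
  · rw [redundancy_eq_ceil_iff one_pos, Nat.cast_one, mul_one, mul_one]
    omega

/-- With `Q = p ^ (s - g)` the redundancy is `p ^ g`, the dimension is `p ^ g * (Q - 1)`, and the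
locality is `Q - 1`. -/
theorem isOptimalCyclicLRC_prime_pow {s g : ℕ} (hg : g < s) :
    IsOptimalCyclicLRC (rootOneCode F (p ^ s) (p ^ g)) (p ^ s - p ^ g) 2 (p ^ (s - g) - 1) := by
  have hp := (Fact.out : p.Prime)
  have hp2 := hp.two_le
  obtain ⟨k, rfl⟩ : ∃ k, s = g + k + 1 := ⟨s - g - 1, by omega⟩
  have hm : 1 ≤ p ^ g := Nat.one_le_pow _ _ hp.pos
  have hk : 1 ≤ p ^ k := Nat.one_le_pow _ _ hp.pos
  have hn : p ^ (g + k + 1) = p * p ^ (g + k) := by rw [pow_succ, mul_comm]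
  have hn' : p ^ (g + k + 1) = p ^ g * p ^ (k + 1) := by rw [add_assoc, pow_add]
  have hQ : 2 ≤ p ^ (k + 1) := by
    rw [pow_succ]
    nlinarith
  have hgk : p ^ g ≤ p ^ (g + k) := Nat.pow_le_pow_right hp.pos (by omega)
  have hsub : (p - 1) * p ^ (g + k) + p ^ (g + k) = p * p ^ (g + k) := by
    rw [← Nat.succ_mul, Nat.succ_eq_add_one, Nat.sub_add_cancel hp.one_le]
  have hmn : p ^ g ≤ p ^ (g + k + 1) := Nat.pow_le_pow_right hp.pos (by omega)
  rw [show g + k + 1 - g = k + 1 by omega]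
  refine (isOptimalCyclicLRC_rootOneCode_iff p (a := p - 1) (e := g + k) (b := 1) (g := g)
    (j := p ^ (g + k + 1) - p ^ g) (by omega) (by omega) (by omega) (by omega) (by omega)
    (by rw [Nat.sub_add_cancel hp.one_le]; omega)
    (by omega) le_rfl (by omega) (by omega) (by omega)).mpr ⟨rfl, ?_, ?_, ?_⟩
  · rw [show g + k + 1 - 1 - (g + k) = 0 by omega, pow_zero]
    omega
  · rw [show g + k + 1 - 1 - g = k by omega, Nat.add_sub_cancel, Nat.sub_add_cancel (by omega),
      pow_succ, mul_comm]
  · rw [redundancy_eq_ceil_iff (by omega)]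
    push_cast [Nat.cast_sub hmn, Nat.cast_sub (by omega : 1 ≤ p ^ (k + 1))]
    have hn'' : (p : ℤ) ^ (g + k + 1) = (p : ℤ) ^ g * (p : ℤ) ^ (k + 1) := by exact_mod_cast hn'
    have hQ' : (2 : ℤ) ≤ (p : ℤ) ^ (k + 1) := by exact_mod_cast hQ
    rw [hn'']
    constructor <;> nlinarith

theorem isOptimalCyclicLRC_exponent_two (hp3 : 3 ≤ p) {s : ℕ} (hs : 2 ≤ s) :
    IsOptimalCyclicLRC (rootOneCode F (p ^ s) 2) (p ^ s - 2) 2 (p ^ s - p ^ (s - 1) - 1) := by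
  have hp := (Fact.out : p.Prime)
  obtain ⟨S, rfl⟩ : ∃ S, s = S + 1 := ⟨s - 1, by omega⟩
  rw [Nat.add_sub_cancel]
  have hq : p ≤ p ^ S := Nat.le_self_pow (by omega) p
  have hn : p ^ (S + 1) = p * p ^ S := by rw [pow_succ, mul_comm]
  have hsub : (p - 1) * p ^ S + p ^ S = p * p ^ S := by
    rw [← Nat.succ_mul, Nat.succ_eq_add_one, Nat.sub_add_cancel hp.one_le]
  have hbig : 2 * p ^ S ≤ (p - 1) * p ^ S := Nat.mul_le_mul_right _ (by omega)
  refine (isOptimalCyclicLRC_rootOneCode_iff p (a := p - 1) (e := S) (b := 2) (g := 0)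
    (j := p ^ (S + 1) - 2) (by omega) (by omega) (by omega) (by omega) (by omega)
    (by rw [Nat.sub_add_cancel hp.one_le]; omega)
    (by omega) (by omega) (by omega) (by simp) (by simp)).mpr ⟨rfl, ?_, ?_, ?_⟩
  · rw [show S + 1 - 1 - S = 0 by omega, pow_zero]
    omega
  · rw [show S + 1 - 1 - 0 = S by omega, show p + 1 - 2 = p - 1 by omega]
    omega
  · rw [redundancy_eq_ceil_iff (by omega)]
    push_cast
    omega

theorem isOptimalCyclicLRC_distance_three (hp3 : 3 ≤ p) {s : ℕ} (hs : 2 ≤ s) :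
    IsOptimalCyclicLRC (rootOneCode F (p ^ s) (p ^ (s - 1) + 1))
      (p ^ s - p ^ (s - 1) - 1) 3 (p - 1) := by
  have hp := (Fact.out : p.Prime)
  obtain ⟨S, rfl⟩ : ∃ S, s = S + 1 := ⟨s - 1, by omega⟩
  rw [Nat.add_sub_cancel]
  have hq : p ≤ p ^ S := Nat.le_self_pow (by omega) p
  have hn : p ^ (S + 1) = p * p ^ S := by rw [pow_succ, mul_comm]
  obtain ⟨c, hc⟩ : ∃ c, p = c + 3 := ⟨p - 3, by omega⟩
  have hn' : p ^ (S + 1) = c * p ^ S + 3 * p ^ S := by rw [hn, ← add_mul, ← hc]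
  refine (isOptimalCyclicLRC_rootOneCode_iff p (a := p - 2) (e := S) (b := 1) (g := S)
    (j := p ^ (S + 1) - p ^ S - 1) (by omega) (by omega) (by omega) (by omega)
    (by rw [show p - 2 = c + 1 by omega, add_mul]; omega)
    (by rw [show p - 2 + 1 = c + 2 by omega, add_mul]; omega)
    (by omega) (by omega) (by omega) (by omega) (by omega)).mpr ⟨rfl, ?_, ?_, ?_⟩
  · rw [show S + 1 - 1 - S = 0 by omega, pow_zero]
    omega
  · rw [show S + 1 - 1 - S = 0 by omega, pow_zero]
    omega
  · rw [redundancy_eq_ceil_iff (by omega), show p - 1 = c + 2 by omega,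
      show p ^ (S + 1) - p ^ S - 1 = c * p ^ S + 2 * p ^ S - 1 by omega,
      Nat.cast_sub (by omega)]
    push_cast
    constructor <;> nlinarith

theorem isOptimalCyclicLRC_repetition {s : ℕ} (hs : 1 ≤ s) :
    IsOptimalCyclicLRC (rootOneCode F (p ^ s) (p ^ s - 1)) 1 (p ^ s) 1 := by
  have hp := (Fact.out : p.Prime)
  have hp2 := hp.two_le
  obtain ⟨S, rfl⟩ : ∃ S, s = S + 1 := ⟨s - 1, by omega⟩
  have hq : 1 ≤ p ^ S := Nat.one_le_pow _ _ hp.pos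
  have hn : p ^ (S + 1) = p * p ^ S := by rw [pow_succ, mul_comm]
  have hsub : (p - 1) * p ^ S + p ^ S = p * p ^ S := by
    rw [← Nat.succ_mul, Nat.succ_eq_add_one, Nat.sub_add_cancel hp.one_le]
  refine (isOptimalCyclicLRC_rootOneCode_iff p (a := 1) (e := 0) (b := p - 1) (g := S)
    (j := 1) (by omega) (by omega) (by omega) (by omega) (by simp) (by simp)
    (by omega) (by omega) (by omega) (by omega)
    (by rw [Nat.sub_add_cancel hp.one_le]; omega)).mpr ⟨rfl, ?_, ?_, ?_⟩
  · rw [Nat.add_sub_cancel, Nat.add_sub_cancel, Nat.sub_zero, hn]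
  · rw [show S + 1 - 1 - S = 0 by omega, pow_zero]
    omega
  · rw [redundancy_eq_ceil_iff one_pos, Nat.cast_one, mul_one, mul_one]
    omega

theorem isOptimalCyclicLRC_prime_length {t : ℕ} (ht : t + 2 ≤ p) :
    IsOptimalCyclicLRC (rootOneCode F p (t + 1)) (p - t - 1) (t + 2) (p - t - 1) := by
  have h := (isOptimalCyclicLRC_rootOneCode_iff (F := F) p (s := 1) (i := t + 1)
    (a := p - t - 1) (e := 0) (b := t + 1) (g := 0) (j := p - t - 1)
    (k := p - t - 1) (d := t + 2) (r := p - t - 1)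
    (by rw [pow_one]; omega) (by omega) (by omega) (by omega) (by simp) (by simp)
    (by omega) (by omega) (by omega) (by simp) (by simp)).mpr ⟨rfl, ?_, ?_, ?_⟩
  · rwa [pow_one] at h
  · simp
    omega
  · simp
    omega
  · rw [redundancy_eq_ceil_iff (by omega)]
    push_cast
    constructor
    · rw [show (t : ℤ) + 1 + 1 - (t + 2) = 0 by ring, zero_mul]
      omega
    · rw [show (t : ℤ) + 1 + 2 - (t + 2) = 1 by ring, one_mul]

end Families

/-! ### Classification -/



section Classification

/-- Here `m = p ^ g` and `b` is the leading digit of the redundancy `i`, which lies below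
`p ^ (s - 1)`, so that the minimum distance is `2`. For `b ≥ 2` the bound forces
`(b - 1) (p - b) m < p - b + 1`. -/
theorem eq_or_eq_two_of_pred_mul_lt {p b m i : ℕ} (hb : 1 ≤ b) (hbp : b < p) (hm : 0 < m)
    (hbi : b * m ≤ i) (hib : i < (b + 1) * m) (h : (i - 1) * (p + 1 - b) < p * m) :
    i = m ∨ i = 2 ∧ 3 ≤ p := by
  rcases Nat.eq_or_lt_of_le hb with rfl | hb2
  · left
    rw [Nat.add_sub_cancel, mul_comm] at h
    have := lt_of_mul_lt_mul_left h (Nat.zero_le p)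
    omega
  · right
    obtain ⟨z, rfl⟩ : ∃ z, b = z + 2 := ⟨b - 2, by omega⟩
    obtain ⟨y, rfl⟩ : ∃ y, p = z + 2 + (y + 1) := ⟨p - (z + 2) - 1, by omega⟩
    rw [show z + 2 + (y + 1) + 1 - (z + 2) = y + 2 by omega] at h
    have hpos : 1 ≤ (z + 2) * m := Nat.mul_pos (by omega) hm
    obtain ⟨x, hx⟩ : ∃ x, (z + 2) * m = x + 1 := ⟨(z + 2) * m - 1, by omega⟩
    have h1 : x * (y + 2) < (z + 2 + (y + 1)) * m :=
      (Nat.mul_le_mul_right _ (by omega : x ≤ i - 1)).trans_lt h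
    have h2 : (z + 1) * m * (y + 1) < y + 2 := by nlinarith
    have h3 : (z + 1) * m < 2 := by
      by_contra hcon
      nlinarith
    have hm1 : m = 1 := by nlinarith
    subst hm1
    omega

/-- Here `q = p ^ (s - 1)`, and `a` and `b` are the leading digits of the dimension `j` and the
redundancy `i`, both at the top position. Then `a + b` is `p` or `p - 1`. -/
theorem eq_or_eq_add_one_of_optimal {p q a b i j : ℕ} (hpq : p ≤ q) (hij : i + j = p * q)
    (ha : 1 ≤ a) (hap : a < p) (hb : 1 ≤ b) (hbp : b < p)
    (haj : a * q ≤ j) (hja : j < (a + 1) * q) (hbi : b * q ≤ i) (hib : i < (b + 1) * q)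
    (h1 : ((i : ℤ) + 1 - (p + 1 - a)) * (p - b) < j)
    (h2 : (j : ℤ) ≤ ((i : ℤ) + 2 - (p + 1 - a)) * (p - b)) :
    i = q ∨ i = q + 1 ∧ 3 ≤ p := by
  have hle : a + b ≤ p := by
    refine le_of_mul_le_mul_right (?_ : (a + b) * q ≤ p * q) (by omega)
    linarith
  have hlt : p < a + b + 2 := by
    refine lt_of_mul_lt_mul_right (?_ : p * q < (a + b + 2) * q) (Nat.zero_le q)
    linarith
  have hjr : (j : ℤ) ≤ q * (p - b) := by
    have hij' : (i : ℤ) + j = p * q := by exact_mod_cast hij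
    have hbi' : (b : ℤ) * q ≤ i := by exact_mod_cast hbi
    linarith
  have hpb : (0 : ℤ) ≤ p - b := by omega
  -- the quotient `j / r` with `r = p - b` is at most `q`
  have hq1 : (i : ℤ) + 1 - (p + 1 - a) < q := lt_of_mul_lt_mul_right (h1.trans_le hjr) hpb
  obtain ⟨c, rfl⟩ : ∃ c, b = c + 1 := ⟨b - 1, by omega⟩
  rw [add_mul, one_mul] at hbi
  have hc : c = 0 := by
    by_contra hc0
    have : c * p ≤ c * q := Nat.mul_le_mul_left c hpq
    have : 1 * q ≤ c * q := Nat.mul_le_mul_right q (by omega)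
    omega
  subst hc
  omega

/-- Here `m = p ^ e` and `P = p ^ (s - 1 - e)`, where `e` is the position of the leading digit `a`
of the dimension `j`, which lies below `p ^ (s - 1) = m * P`, so that the locality is `1`. -/
theorem eq_pred_or_eq_add_one_of_optimal {p m P a i j : ℕ} (hp : 2 ≤ p) (hP : p ≤ P)
    (hm : m = 1 ∨ p ≤ m) (hij : i + j = p * (m * P)) (ha : 1 ≤ a) (hap : a < p)
    (haj : a * m ≤ j) (hja : j < (a + 1) * m)
    (h : p * (m * P) + 2 = 2 * j + (p + 1 - a) * P) :
    i = p * (m * P) - 1 ∨ p = 2 ∧ i = m * P + 1 := by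
  rcases hm with rfl | hm
  · left
    obtain rfl : j = a := by omega
    obtain ⟨c, rfl⟩ : ∃ c, j = c + 1 := ⟨j - 1, by omega⟩
    obtain ⟨y, rfl⟩ : ∃ y, p = c + 1 + y := ⟨p - (c + 1), by omega⟩
    rw [show c + 1 + y + 1 - (c + 1) = y + 1 by omega] at h
    have hc : c * P = c * 2 := by linarith
    have hc0 : c = 0 := by
      by_contra hne
      have := Nat.eq_of_mul_eq_mul_left (Nat.pos_of_ne_zero hne) hc
      omega
    omega
  · right
    rcases Nat.eq_or_lt_of_le hp with rfl | hp3
    · obtain rfl : a = 1 := by omega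
      rw [show 2 + 1 - 1 = 2 by rfl] at h
      refine ⟨rfl, ?_⟩
      obtain ⟨y, rfl⟩ : ∃ y, P = y + 2 := ⟨P - 2, by omega⟩
      have hy : y = 0 := by
        by_contra hne
        have : 1 * 1 ≤ (m - 1) * y := Nat.mul_le_mul (by omega) (by omega)
        obtain ⟨x, rfl⟩ : ∃ x, m = x + 1 := ⟨m - 1, by omega⟩
        rw [Nat.add_sub_cancel] at this
        nlinarith
      subst hy
      omega
    · exfalso
      have h1 : (p + 1 - a) * P ≤ m * P := Nat.mul_le_mul_right _ (by omega)
      have h2 : (a + 1) * m ≤ m * P := by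
        rw [mul_comm m]
        exact Nat.mul_le_mul_right _ (by omega)
      have h3 : 3 * (m * P) ≤ p * (m * P) := Nat.mul_le_mul_right _ hp3
      omega

end Classification

section Families

variable {F : Type*} [Field F] (p : ℕ) [Fact p.Prime] [CharP F p]

/-- The redundancy `i` and the dimension `j` add up to `p ^ s`, so at least one of their leading
digits is at the top position `s - 1`; the three cases are settled separately. -/
theorem eq_of_isOptimalCyclicLRC {s i k d r : ℕ} (hs : 1 ≤ s) (hi : 1 ≤ i) (his : i ≤ p ^ s - 1)
    (h : IsOptimalCyclicLRC (rootOneCode F (p ^ s) i) k d r) :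
    (p = 2 ∧ 2 ≤ s ∧ i = 2 ^ (s - 1) + 1) ∨
    (2 ≤ s ∧ ∃ k : ℕ, 1 ≤ k ∧ k ≤ s - 1 ∧ i = p ^ (s - k - 1)) ∨
    (3 ≤ p ∧ 2 ≤ s ∧ i = 2) ∨
    (3 ≤ p ∧ 2 ≤ s ∧ i = p ^ (s - 1) + 1) ∨
    i = p ^ (s - 1) ∨
    i = p ^ s - 1 ∨
    (s = 1 ∧ ∃ t : ℕ, t + 2 ≤ p ∧ i = t + 1) := by
  have hp := (Fact.out : p.Prime)
  have hp2 := hp.two_le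
  obtain ⟨S, rfl⟩ : ∃ S, s = S + 1 := ⟨s - 1, by omega⟩
  have hq : 1 ≤ p ^ S := Nat.one_le_pow _ _ hp.pos
  have hn : p ^ (S + 1) = p * p ^ S := by rw [pow_succ, mul_comm]
  have hnq : 2 * p ^ S ≤ p * p ^ S := Nat.mul_le_mul_right _ hp2
  obtain ⟨j, hij⟩ : ∃ j, i + j = p ^ (S + 1) := ⟨p ^ (S + 1) - i, by omega⟩
  obtain ⟨e, a, he, ha, hap, haj, hja⟩ :=
    exists_leading_digit hp.one_lt (by omega : 1 ≤ j) (by omega : j < p ^ (S + 1))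
  obtain ⟨g, b, hg, hb, hbp, hbi, hib⟩ :=
    exists_leading_digit hp.one_lt hi (by omega : i < p ^ (S + 1))
  obtain ⟨-, hd, hr, hopt⟩ := (isOptimalCyclicLRC_rootOneCode_iff p hij he ha hap haj hja hg hb
    hbp hbi hib).mp h
  have hrpos : 0 < r := by
    have : 2 * 1 ≤ (p + 1 - b) * p ^ (S + 1 - 1 - g) :=
      Nat.mul_le_mul (by omega) (Nat.one_le_pow _ _ hp.pos)
    omega
  rw [redundancy_eq_ceil_iff hrpos] at hopt
  obtain ⟨hopt1, hopt2⟩ := hopt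
  rw [Nat.add_sub_cancel] at hd hr ⊢
  -- a number whose leading digit is below the top position is below `p ^ S`
  have hsmall : ∀ x c f, c < p → f < S → x < (c + 1) * p ^ f → x < p ^ S := by
    intro x c f hc hf hx
    calc x < (c + 1) * p ^ f := hx
      _ ≤ p * p ^ f := Nat.mul_le_mul_right _ hc
      _ = p ^ (f + 1) := by rw [pow_succ, mul_comm]
      _ ≤ p ^ S := Nat.pow_le_pow_right hp.pos hf
  have htop : ∀ x c, (p - 1) * p ^ S < x → c < p → x < (c + 1) * p ^ S → c = p - 1 := by
    intro x c hx hc hxc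
    have := lt_of_mul_lt_mul_right (hx.trans hxc) (Nat.zero_le _)
    omega
  have hsub : (p - 1) * p ^ S + p ^ S = p * p ^ S := by
    rw [← Nat.succ_mul, Nat.succ_eq_add_one, Nat.sub_add_cancel hp.one_le]
  rcases Nat.lt_or_ge g S with hgS | hgS
  · have hiq := hsmall i b g hbp hgS hib
    have heS : e = S := by
      by_contra hne
      have := hsmall j a e hap (by omega) hja
      omega
    subst heS
    obtain rfl := htop j a (by omega) hap hja
    rw [Nat.sub_self, pow_zero, mul_one] at hd
    obtain rfl : d = 2 := by omega
    have hmP : p ^ g * p ^ (e - g) = p ^ e := by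
      rw [← pow_add]
      congr 1
      omega
    have hlt : (i - 1) * (p + 1 - b) < p * p ^ g := by
      refine lt_of_mul_lt_mul_right (?_ : _ * p ^ (e - g) < _ * p ^ (e - g)) (Nat.zero_le _)
      rw [mul_assoc, mul_assoc, hmP, ← hr, ← hn, ← hij]
      obtain ⟨x, rfl⟩ : ∃ x, i = x + 1 := ⟨i - 1, by omega⟩
      have : ((x * r : ℕ) : ℤ) < j := by
        refine lt_of_eq_of_lt ?_ hopt1
        push_cast
        ring
      have : x * r < j := by exact_mod_cast this
      rw [Nat.add_sub_cancel, mul_add, mul_one]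
      omega
    rcases eq_or_eq_two_of_pred_mul_lt hb hbp (pow_pos hp.pos g) hbi hib hlt with h1 | ⟨h1, h3⟩
    · exact Or.inr (Or.inl ⟨by omega, e - g, by omega, by omega, by
        rw [h1]
        congr 1
        omega⟩)
    · exact Or.inr (Or.inr (Or.inl ⟨h3, by omega, h1⟩))
  · obtain rfl : g = S := by omega
    rw [Nat.sub_self, pow_zero, mul_one] at hr
    rcases Nat.lt_or_ge e g with heg | heg
    · have hjq := hsmall j a e hap heg hja
      obtain rfl := htop i b (by omega) hbp hib
      obtain rfl : r = 1 := by omega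
      have hmP : p ^ e * p ^ (g - e) = p ^ g := by
        rw [← pow_add]
        congr 1
        omega
      have heq : p * (p ^ e * p ^ (g - e)) + 2 = 2 * j + (p + 1 - a) * p ^ (g - e) := by
        rw [hmP, ← hn, ← hij, ← hd]
        rw [Nat.cast_one, mul_one] at hopt1 hopt2
        omega
      have hm : p ^ e = 1 ∨ p ≤ p ^ e := by
        rcases Nat.eq_zero_or_pos e with rfl | he0
        · left; rfl
        · right; exact Nat.le_self_pow he0.ne' p
      have := eq_pred_or_eq_add_one_of_optimal hp2 (Nat.le_self_pow (by omega) p) hm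
        (by rw [hmP, ← hn, hij]) ha hap haj hja heq
      rw [hmP, ← hn] at this
      rcases this with h1 | ⟨rfl, h1⟩
      · exact Or.inr (Or.inr (Or.inr (Or.inr (Or.inr (Or.inl h1)))))
      · exact Or.inl ⟨rfl, by omega, h1⟩
    · obtain rfl : e = g := by omega
      rw [Nat.sub_self, pow_zero, mul_one] at hd
      rcases Nat.eq_zero_or_pos e with rfl | he0
      · refine Or.inr (Or.inr (Or.inr (Or.inr (Or.inr (Or.inr ⟨rfl, i - 1, ?_, by omega⟩)))))
        rw [zero_add, pow_one] at his
        omega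
      · have hdz : (d : ℤ) = p + 1 - a := by omega
        have hrz : (r : ℤ) = p - b := by omega
        rw [hdz, hrz] at hopt1 hopt2
        rcases eq_or_eq_add_one_of_optimal (Nat.le_self_pow he0.ne' p) (by rw [hij, hn]) ha hap hb
          hbp haj hja hbi hib hopt1 hopt2 with h1 | ⟨h1, h3⟩
        · exact Or.inr (Or.inr (Or.inr (Or.inr (Or.inl h1))))
        · exact Or.inr (Or.inr (Or.inr (Or.inl ⟨h3, by omega, h1⟩)))

end Families

theorem mainTheorem6 {F : Type*} [Field F] [Finite F] (p : ℕ) [Fact p.Prime] [CharP F p] :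
    -- length 2^s, distance 4, locality 1
    (p = 2 → ∀ s : ℕ, 2 ≤ s →
      IsOptimalCyclicLRC (rootOneCode F (2 ^ s) (2 ^ (s - 1) + 1)) (2 ^ (s - 1) - 1) 4 1) ∧
    -- distance 2, locality p^(k+1) - 1
    (∀ s k : ℕ, 2 ≤ s → 1 ≤ k → k ≤ s - 1 →
      IsOptimalCyclicLRC (rootOneCode F (p ^ s) (p ^ (s - k - 1)))
        (p ^ s - p ^ (s - k - 1)) 2 (p ^ (k + 1) - 1)) ∧
    -- exponent 2
    (3 ≤ p → ∀ s : ℕ, 2 ≤ s →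
      IsOptimalCyclicLRC (rootOneCode F (p ^ s) 2) (p ^ s - 2) 2 (p ^ s - p ^ (s - 1) - 1)) ∧
    -- distance 3
    (3 ≤ p → ∀ s : ℕ, 2 ≤ s →
      IsOptimalCyclicLRC (rootOneCode F (p ^ s) (p ^ (s - 1) + 1))
        (p ^ s - p ^ (s - 1) - 1) 3 (p - 1)) ∧
    -- distance 2, locality p - 1
    (∀ s : ℕ, 1 ≤ s →
      IsOptimalCyclicLRC (rootOneCode F (p ^ s) (p ^ (s - 1))) (p ^ s - p ^ (s - 1)) 2 (p - 1)) ∧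
    -- the lengths in each of the five classes are unbounded, for the fixed field
    (∀ N : ℕ, ∃ s : ℕ, 2 ≤ s ∧ N < p ^ s) ∧
    -- first further family
    (∀ s : ℕ, 1 ≤ s →
      IsOptimalCyclicLRC (rootOneCode F (p ^ s) (p ^ s - 1)) 1 (p ^ s) 1) ∧
    -- second further family
    (∀ t : ℕ, t + 2 ≤ p →
      IsOptimalCyclicLRC (rootOneCode F p (t + 1)) (p - t - 1) (t + 2) (p - t - 1)) ∧
    -- there are no others
    (∀ s i : ℕ, 1 ≤ s → 1 ≤ i → i ≤ p ^ s - 1 →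
      (∃ k d r : ℕ, IsOptimalCyclicLRC (rootOneCode F (p ^ s) i) k d r) →
        (p = 2 ∧ 2 ≤ s ∧ i = 2 ^ (s - 1) + 1) ∨
        (2 ≤ s ∧ ∃ k : ℕ, 1 ≤ k ∧ k ≤ s - 1 ∧ i = p ^ (s - k - 1)) ∨
        (3 ≤ p ∧ 2 ≤ s ∧ i = 2) ∨
        (3 ≤ p ∧ 2 ≤ s ∧ i = p ^ (s - 1) + 1) ∨
        i = p ^ (s - 1) ∨
        i = p ^ s - 1 ∨
        (s = 1 ∧ ∃ t : ℕ, t + 2 ≤ p ∧ i = t + 1)) := by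
  have hp := (Fact.out : p.Prime)
  refine ⟨fun hp2 s hs => isOptimalCyclicLRC_two_pow p hp2 hs, fun s k hs hk hks => ?_,
    fun hp3 s hs => isOptimalCyclicLRC_exponent_two p hp3 hs,
    fun hp3 s hs => isOptimalCyclicLRC_distance_three p hp3 hs, fun s hs => ?_, fun N => ?_,
    fun s hs => isOptimalCyclicLRC_repetition p hs,
    fun t ht => isOptimalCyclicLRC_prime_length p ht,
    fun s i hs hi his ⟨k, d, r, h⟩ => eq_of_isOptimalCyclicLRC p hs hi his h⟩
  · have h := isOptimalCyclicLRC_prime_pow (F := F) p (by omega : s - k - 1 < s)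
    rwa [show s - (s - k - 1) = k + 1 by omega] at h
  · have h := isOptimalCyclicLRC_prime_pow (F := F) p (by omega : s - 1 < s)
    rwa [show s - (s - 1) = 1 by omega, pow_one] at h
  · exact ⟨N + 2, by omega, (Nat.lt_pow_self hp.one_lt).trans
      (Nat.pow_lt_pow_right hp.one_lt (by omega))⟩
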